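/- **Lemma 3.6.** Let $D=(-\Delta)^{1/2}$ on $\mathbb{R}^3$ and let $\dot H^{1/2}(\mathbb{R}^3)$ be the space of tempered distributions $h$ whose Fourier transform $\hat h$ is a locally integrable function with $\|h\|_{\dot H^{1/2}}:=\|D^{1/2}h\|_{L^2(\mathbb{R}^3)}<\infty$. Let $e^{it\Delta}$ be the free Schrödinger group. Let $A\in\mathbb{R}$ and let $(h_n)_{n\in\mathbb{N}}$ be a sequence in $\dot H^{1/2}(\mathbb{R}^3)$ such that $\|h_n\|_{\dot H^{1/2}}\le A$ for all $n$ and $$\|e^{it\Delta}h_n\|_{L^5_t((0,\infty);L^5_x(\mathbb{R}^3))}\longrightarrow 0\qquad (n\to\infty).$$ Then $D^{1/2}h_n\rightharpoonup 0$ weakly in $L^2(\mathbb{R}^3)$ as $n\to\infty$. -/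

import Mathlib

open MeasureTheory Filter Topology SchwartzMap FourierTransform
open scoped ENNReal

noncomputable section

namespace NLS

/-- Physical space `ℝ³` (also used as frequency space). -/
abbrev R3 : Type := EuclideanSpace ℝ (Fin 3)

/-- With Mathlib's convention `𝓕 f ξ = ∫ exp (-2πi ⟨x, ξ⟩) f x`, the operator `-i∇` has symbol `2πξ`,
so `D = (-Δ)^{1/2}` has symbol `2π|ξ|` and `D ^ s` has symbol `(2π|ξ|) ^ s`. -/
def symbolD (s : ℝ) (ξ : R3) : ℂ := (((2 * Real.pi * ‖ξ‖) ^ s : ℝ) : ℂ)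

/-- `f` is the Fourier transform of the `Ḣ ^ s` distribution `h`: the tempered distribution `𝓕 h` is
the locally integrable function `f`, and `(2π|ξ|) ^ s f(ξ)` is square integrable. -/
structure IsHDotFourier (s : ℝ) (h : 𝓢'(R3, ℂ)) (f : R3 → ℂ) : Prop where
  locallyIntegrable : LocallyIntegrable f
  memLp : MemLp (fun ξ => symbolD s ξ * f ξ) 2
  fourier_eq : ∀ φ : 𝓢(R3, ℂ), (𝓕 h : 𝓢'(R3, ℂ)) φ = ∫ ξ, φ ξ * f ξ

/-- Membership in the homogeneous Sobolev space `Ḣ ^ s (ℝ³)` (used for `s = 1/2`; this realization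
by tempered distributions is the standard, complete, one for `|s| < 3/2`). -/
def MemHDot (s : ℝ) (h : 𝓢'(R3, ℂ)) : Prop := ∃ f : R3 → ℂ, IsHDotFourier s h f

/-- `D ^ s h ∈ L²` for `h ∈ Ḣ ^ s`: the inverse Fourier transform of `(2π|ξ|) ^ s (𝓕 h)(ξ)`. -/
def fracD (s : ℝ) (h : 𝓢'(R3, ℂ)) (hh : MemHDot s h) : Lp ℂ 2 (volume : Measure R3) :=
  𝓕⁻ (hh.choose_spec.memLp.toLp (fun ξ => symbolD s ξ * hh.choose ξ))

/-- The norm `‖h‖_{Ḣ ^ s} = ‖D ^ s h‖_{L²}`. -/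
def hDotNorm (s : ℝ) (h : 𝓢'(R3, ℂ)) (hh : MemHDot s h) : ℝ := ‖fracD s h hh‖

/-- The symbol `exp (-i t (2π|ξ|)²)` of `exp (itΔ)`. -/
def schrodingerSymbol (t : ℝ) (ξ : R3) : ℂ :=
  Complex.exp (-Complex.I * ((t * (2 * Real.pi * ‖ξ‖) ^ 2 : ℝ) : ℂ))

/-- The free Schrödinger group `exp (itΔ)` on tempered distributions. -/
def schrodinger (t : ℝ) : 𝓢'(R3, ℂ) →L[ℂ] 𝓢'(R3, ℂ) :=
  TemperedDistribution.fourierMultiplierCLM ℂ (schrodingerSymbol t)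

/-- The `L ^ p (ℝ³)` norm of a tempered distribution: the norm of the `L ^ p` function that
represents it, and `∞` if there is none. -/
def distLpNorm (p : ℝ≥0∞) [Fact (1 ≤ p)] (T : 𝓢'(R3, ℂ)) : ℝ≥0∞ :=
  ⨅ (f : Lp ℂ p (volume : Measure R3)) (_ : (f : 𝓢'(R3, ℂ)) = T), ‖f‖ₑ

instance : Fact ((1 : ℝ≥0∞) ≤ 5) := ⟨by norm_num⟩

/-- The norm `‖v‖_{S(I)} = ‖v‖_{L⁵_t(I; L⁵_x(ℝ³))}` of `v : t ↦ v(t)`. -/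
def sNorm (I : Set ℝ) (v : ℝ → 𝓢'(R3, ℂ)) : ℝ≥0∞ :=
  (∫⁻ t in I, distLpNorm 5 (v t) ^ (5 : ℝ)) ^ (1 / 5 : ℝ)

/-- The Fourier transform of `h` is unique as a function up to null sets, so `fracD` does not depend
on the choice made in its definition. -/
theorem IsHDotFourier.ae_eq {s s' : ℝ} {h : 𝓢'(R3, ℂ)} {f g : R3 → ℂ} (hf : IsHDotFourier s h f)
    (hg : IsHDotFourier s' h g) : f =ᵐ[volume] g := by
  refine ae_eq_of_integral_contDiff_smul_eq hf.locallyIntegrable hg.locallyIntegrable ?_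
  intro φ hφ hc
  have h₁ : HasCompactSupport (Complex.ofRealCLM ∘ φ) := hc.comp_left rfl
  have h₂ : ContDiff ℝ (⊤ : ℕ∞) (Complex.ofRealCLM ∘ φ) := Complex.ofRealCLM.contDiff.comp hφ
  have e := (hf.fourier_eq (h₁.toSchwartzMap h₂)).symm.trans (hg.fourier_eq (h₁.toSchwartzMap h₂))
  simpa using e

theorem fracD_eq {s : ℝ} {h : 𝓢'(R3, ℂ)} (hh : MemHDot s h) {f : R3 → ℂ}
    (hf : IsHDotFourier s h f) :
    fracD s h hh = 𝓕⁻ (hf.memLp.toLp (fun ξ => symbolD s ξ * f ξ)) := by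
  unfold fracD
  congr 1
  refine MemLp.toLp_congr _ _ ?_
  filter_upwards [hh.choose_spec.ae_eq hf] with ξ hξ
  rw [hξ]

/-- The symbol of `exp (itΔ)` is smooth with derivatives of polynomial growth, so the multiplier
`schrodinger t` is a genuine one. -/
theorem schrodingerSymbol_hasTemperateGrowth (t : ℝ) :
    (schrodingerSymbol t).HasTemperateGrowth := by
  have key : (fun x : ℝ => Complex.exp ((-Complex.I) * (x : ℂ))).HasTemperateGrowth := by
    have hd : ∀ n : ℕ, iteratedDeriv n (fun x : ℝ => Complex.exp ((-Complex.I) * (x : ℂ))) =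
        fun x : ℝ => (-Complex.I) ^ n * Complex.exp ((-Complex.I) * (x : ℂ)) := by
      intro n
      induction n with
      | zero => simp
      | succ n ih =>
        rw [iteratedDeriv_succ, ih]
        funext x
        have h1 : HasDerivAt (fun x : ℝ => (-Complex.I) * (x : ℂ)) (-Complex.I) x := by
          simpa using (Complex.ofRealCLM.hasDerivAt (x := x)).const_mul (-Complex.I)
        rw [(h1.cexp.const_mul ((-Complex.I) ^ n)).deriv]
        ring
    refine ⟨?_, fun n => ⟨0, 1, fun x => ?_⟩⟩
    · exact Complex.contDiff_exp.comp (contDiff_const.mul Complex.ofRealCLM.contDiff)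
    · rw [norm_iteratedFDeriv_eq_norm_iteratedDeriv, hd]
      have : ‖Complex.exp ((-Complex.I) * (x : ℂ))‖ = 1 := by
        rw [Complex.norm_exp]; simp
      rw [norm_mul, norm_pow, norm_neg, Complex.norm_I, this]
      norm_num
  have hq : (fun ξ : R3 => t * (2 * Real.pi * ‖ξ‖) ^ 2).HasTemperateGrowth := by
    have : (fun ξ : R3 => t * (2 * Real.pi * ‖ξ‖) ^ 2) =
        fun ξ : R3 => (t * (2 * Real.pi) ^ 2) * ‖ξ‖ ^ 2 := by
      funext ξ; ring
    rw [this]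
    exact (Function.HasTemperateGrowth.const _).mul (Function.hasTemperateGrowth_norm_sq R3)
  exact key.comp hq

end NLS

end

/-! Write `g_n = (2π|ξ|)^{1/2} 𝓕 h_n`, bounded in `L²` by Plancherel. Weak convergence of `g_n` may
be tested on a total set, here the functions `(2π|ξ|)^{3/2} φ` with `φ` Schwartz. That pairing is
`v_n 0`, where `v_n t` is `exp (itΔ) h_n` tested against the fixed Schwartz function `𝓕 ((2π|ξ|)²
φ)`. Uniformly in `n`, `|v_n t - v_n 0| ≤ L t` (`norm_schrodinger_apply_sub_le`), and Hölder bounds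
`|v_n t|` by a multiple of the `L⁵` norm of `exp (itΔ) h_n`. If `|v_n 0| ≥ ε`, then `|v_n| ≥ ε / 2`
on a time interval of fixed length, so the `L⁵` space-time norm is bounded below
(`exists_le_lintegral_of_lipschitz_at_zero`), which fails for large `n`. -/

/-- In a Hilbert space, a bounded sequence that tests to zero against a set with trivial orthogonal
complement tests to zero against every vector. -/
theorem tendsto_inner_zero_of_forall_mem {H : Type*} [NormedAddCommGroup H]
    [InnerProductSpace ℂ H] [CompleteSpace H] {S : Set H}
    (hS : ∀ v : H, (∀ s ∈ S, inner ℂ s v = 0) → v = 0) {x : ℕ → H} {A : ℝ}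
    (hA : ∀ n, ‖x n‖ ≤ A)
    (hx : ∀ s ∈ S, Tendsto (fun n => inner ℂ s (x n)) atTop (𝓝 0)) (v : H) :
    Tendsto (fun n => inner ℂ v (x n)) atTop (𝓝 0) := by
  have hspan : ∀ s ∈ Submodule.span ℂ S, Tendsto (fun n => inner ℂ s (x n)) atTop (𝓝 0) := by
    intro s hs
    induction hs using Submodule.span_induction with
    | mem s hs => exact hx s hs
    | zero => simp
    | add a b _ _ ha hb => simpa [inner_add_left] using ha.add hb
    | smul c a _ ha => simpa [inner_smul_left, mul_comm] using ha.const_mul (starRingEnd ℂ c)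
  have hdense : (Submodule.span ℂ S).topologicalClosure = ⊤ := by
    rw [Submodule.topologicalClosure_eq_top_iff, Submodule.eq_bot_iff]
    intro w hw
    exact hS w fun s hs => hw s (Submodule.subset_span hs)
  have hA0 : 0 ≤ A := (norm_nonneg _).trans (hA 0)
  rw [Metric.tendsto_atTop]
  intro ε hε
  have hv : v ∈ closure (Submodule.span ℂ S : Set H) := by
    rw [← Submodule.topologicalClosure_coe, hdense]; trivial
  obtain ⟨s, hs, hvs⟩ := Metric.mem_closure_iff.1 hv (ε / (2 * (A + 1))) (by positivity)
  obtain ⟨N, hN⟩ := Metric.tendsto_atTop.1 (hspan s hs) (ε / 2) (by positivity)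
  refine ⟨N, fun n hn => ?_⟩
  have h1 : ‖inner ℂ s (x n)‖ < ε / 2 := by simpa using hN n hn
  have h2 : ‖inner ℂ (v - s) (x n)‖ ≤ ε / 2 := by
    refine (norm_inner_le_norm _ _).trans ?_
    rw [dist_eq_norm] at hvs
    calc ‖v - s‖ * ‖x n‖ ≤ ε / (2 * (A + 1)) * (A + 1) := by
          gcongr
          linarith [hA n]
      _ = ε / 2 := by field_simp
  have h3 : inner ℂ v (x n) = inner ℂ (v - s) (x n) + inner ℂ s (x n) := by
    rw [← inner_add_left, sub_add_cancel]
  rw [dist_zero_right, h3]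
  linarith [norm_add_le (inner ℂ (v - s) (x n)) (inner ℂ s (x n))]

/-- The Cauchy-Schwarz inequality for square-integrable functions. -/
theorem integral_norm_mul_norm_le_of_memLp_two {α : Type*} [MeasurableSpace α] {μ : Measure α}
    {f g : α → ℂ} (hf : MemLp f 2 μ) (hg : MemLp g 2 μ) :
    ∫ x, ‖f x‖ * ‖g x‖ ∂μ ≤ ‖hf.toLp f‖ * ‖hg.toLp g‖ := by
  have h := real_inner_le_norm (hf.norm.toLp _) (hg.norm.toLp _)
  rw [L2.inner_def] at h
  have e : ∫ x, inner ℝ ((hf.norm.toLp _) x) ((hg.norm.toLp _) x) ∂μ =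
      ∫ x, ‖f x‖ * ‖g x‖ ∂μ := by
    refine integral_congr_ae ?_
    filter_upwards [hf.norm.coeFn_toLp, hg.norm.coeFn_toLp] with x h1 h2
    rw [h1, h2]
    simp [mul_comm]
  rw [e] at h
  simpa only [Lp.norm_toLp, eLpNorm_norm] using h

/-- The mass of `v` on an interval controls its value at the left end point, for functions that
satisfy a Lipschitz condition there. The majorant `F` need not be measurable. -/
theorem exists_le_lintegral_of_lipschitz_at_zero {L C ε : ℝ} (hL : 0 ≤ L) (hC : 0 ≤ C)
    (hε : 0 < ε) :
    ∃ η : ℝ≥0∞, 0 < η ∧ ∀ (v : ℝ → ℂ) (F : ℝ → ℝ≥0∞),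
      (∀ t, 0 ≤ t → ‖v t - v 0‖ ≤ L * t) → (∀ t, ‖v t‖ₑ ≤ ENNReal.ofReal C * F t) →
      ε ≤ ‖v 0‖ → η ≤ (∫⁻ t in Set.Ioi (0 : ℝ), F t ^ (5 : ℝ)) ^ (1 / 5 : ℝ) := by
  -- On `(0, δ]` the value drops by at most `ε / 2`, so `F ≥ k` there; `L + 1` and `C + 1` avoid
  -- division by zero.
  set δ : ℝ := ε / (2 * (L + 1)) with hδ
  have hδ0 : 0 < δ := by positivity
  set k : ℝ≥0∞ := ENNReal.ofReal (ε / 2) / ENNReal.ofReal (C + 1) with hk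
  have hk0 : 0 < k := ENNReal.div_pos (by simpa using hε) ENNReal.ofReal_ne_top
  refine ⟨(k ^ (5 : ℝ) * ENNReal.ofReal δ) ^ (1 / 5 : ℝ), ?_, fun v F hv hF h0 => ?_⟩
  · have hk' : k ≠ ⊤ := ENNReal.div_ne_top ENNReal.ofReal_ne_top (by
      simp only [ne_eq, ENNReal.ofReal_eq_zero, not_le]; linarith)
    refine ENNReal.rpow_pos ?_ (ENNReal.mul_ne_top ?_ ENNReal.ofReal_ne_top)
    · exact ENNReal.mul_pos (ENNReal.rpow_pos hk0 hk').ne' (by simpa using hδ0)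
    · exact ENNReal.rpow_ne_top_of_nonneg (by norm_num) hk'
  · refine ENNReal.rpow_le_rpow ?_ (by norm_num)
    calc k ^ (5 : ℝ) * ENNReal.ofReal δ = ∫⁻ _ in Set.Ioc (0 : ℝ) δ, k ^ (5 : ℝ) := by simp
      _ ≤ ∫⁻ t in Set.Ioc (0 : ℝ) δ, F t ^ (5 : ℝ) := by
          refine setLIntegral_mono' measurableSet_Ioc fun t ht => ?_
          refine ENNReal.rpow_le_rpow ?_ (by norm_num)
          refine ENNReal.div_le_of_le_mul' ?_
          calc ENNReal.ofReal (ε / 2) ≤ ‖v t‖ₑ := by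
                rw [← ofReal_norm]
                refine ENNReal.ofReal_le_ofReal ?_
                have h1 := hv t ht.1.le
                have h2 : L * t ≤ ε / 2 := by
                  calc L * t ≤ (L + 1) * δ := by
                        have := ht.1.le
                        have := ht.2
                        gcongr
                        linarith
                    _ = ε / 2 := by rw [hδ]; field_simp
                have h3 := norm_sub_norm_le (v 0) (v t)
                rw [norm_sub_rev] at h3
                linarith
            _ ≤ ENNReal.ofReal C * F t := hF t
            _ ≤ ENNReal.ofReal (C + 1) * F t := by
                gcongr
                linarith
      _ ≤ _ := lintegral_mono_set Set.Ioc_subset_Ioi_self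

/-! ### Testing distributions in `L ^ p` -/

/-- Pairing with a fixed Schwartz function is bounded in `L ^ p`. -/
theorem exists_norm_toTemperedDistribution_apply_le (p : ℝ≥0∞) [hp : Fact (1 ≤ p)]
    (θ : 𝓢(NLS.R3, ℂ)) :
    ∃ C : ℝ, 0 ≤ C ∧ ∀ f : Lp ℂ p (volume : Measure NLS.R3),
      ‖(f : 𝓢'(NLS.R3, ℂ)) θ‖ ≤ C * ‖f‖ := by
  have := ENNReal.HolderConjugate.inv_one_sub_inv' hp.out
  have : Fact (1 ≤ (1 - p⁻¹)⁻¹) := by simp [fact_iff]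
  let B := (ContinuousLinearMap.lsmul ℂ ℂ (E := ℂ)).flip.lpPairing
    (volume : Measure NLS.R3) p (1 - p⁻¹)⁻¹
  refine ⟨‖B‖ * ‖θ.toLp (1 - p⁻¹)⁻¹‖, by positivity, fun f => ?_⟩
  have e : (f : 𝓢'(NLS.R3, ℂ)) θ = B f (θ.toLp (1 - p⁻¹)⁻¹) := by
    rw [Lp.toTemperedDistribution_apply, ContinuousLinearMap.lpPairing_eq_integral]
    refine integral_congr_ae ?_
    filter_upwards [θ.coeFn_toLp (1 - p⁻¹)⁻¹ volume] with x hx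
    rw [hx]
    simp
  rw [e]
  have h := B.le_opNorm₂ f (θ.toLp (1 - p⁻¹)⁻¹)
  rwa [mul_right_comm] at h

theorem exists_enorm_apply_le_distLpNorm (p : ℝ≥0∞) [Fact (1 ≤ p)] (θ : 𝓢(NLS.R3, ℂ)) :
    ∃ C : ℝ, 0 ≤ C ∧ ∀ T : 𝓢'(NLS.R3, ℂ), ‖T θ‖ₑ ≤ ENNReal.ofReal C * NLS.distLpNorm p T := by
  obtain ⟨C, hC, h⟩ := exists_norm_toTemperedDistribution_apply_le p θ
  -- A positive constant is essential: with `C = 0` the bound would fail when no `L ^ p` function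
  -- represents `T`, since `0 * ∞ = 0`.
  refine ⟨C + 1, by positivity, fun T => ?_⟩
  rw [← ENNReal.div_le_iff' (by simp only [ne_eq, ENNReal.ofReal_eq_zero, not_le]; linarith)
    ENNReal.ofReal_ne_top]
  refine le_iInf₂ fun f hf => ENNReal.div_le_of_le_mul' ?_
  rw [← hf, ← ofReal_norm, ← ofReal_norm, ← ENNReal.ofReal_mul (by positivity)]
  refine ENNReal.ofReal_le_ofReal ((h f).trans ?_)
  gcongr
  linarith

/-! ### Weights `(2π|ξ|) ^ s` and their test functions -/

theorem symbolD_mul_symbolD {s s' : ℝ} (h : s + s' ≠ 0) (ξ : NLS.R3) :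
    NLS.symbolD s ξ * NLS.symbolD s' ξ = NLS.symbolD (s + s') ξ := by
  unfold NLS.symbolD
  rw [← Complex.ofReal_mul, Real.rpow_add' (by positivity) h]

theorem continuous_symbolD {s : ℝ} (hs : 0 ≤ s) : Continuous (NLS.symbolD s) := by
  unfold NLS.symbolD
  exact Complex.continuous_ofReal.comp
    ((continuous_const.mul continuous_norm).rpow_const fun _ => Or.inr hs)

theorem symbolD_ne_zero (s : ℝ) {ξ : NLS.R3} (hξ : ξ ≠ 0) : NLS.symbolD s ξ ≠ 0 := by
  have : 0 < 2 * Real.pi * ‖ξ‖ := by have := norm_pos_iff.2 hξ; positivity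
  exact Complex.ofReal_ne_zero.2 (Real.rpow_pos_of_pos this s).ne'

theorem norm_symbolD (s : ℝ) (ξ : NLS.R3) : ‖NLS.symbolD s ξ‖ = (2 * Real.pi * ‖ξ‖) ^ s := by
  unfold NLS.symbolD
  rw [Complex.norm_real, Real.norm_of_nonneg (by positivity)]

theorem symbolD_two_hasTemperateGrowth : (NLS.symbolD 2).HasTemperateGrowth := by
  have h : NLS.symbolD 2 = fun ξ : NLS.R3 => (2 * Real.pi : ℂ) ^ 2 * ((‖ξ‖ ^ 2 : ℝ) : ℂ) := by
    funext ξ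
    simp [NLS.symbolD, mul_pow]
  rw [h]
  exact (Function.HasTemperateGrowth.const _).mul
    (Complex.ofRealCLM.hasTemperateGrowth.comp (Function.hasTemperateGrowth_norm_sq NLS.R3))

/-- The weight need not be smooth at the origin, so the product need not be Schwartz; `r ^ s ≤ 1 + r
^ 2` still dominates it by Schwartz functions. -/
theorem memLp_symbolD_mul_schwartz {s : ℝ} (hs : 0 ≤ s) (hs2 : s ≤ 2) (φ : 𝓢(NLS.R3, ℂ)) :
    MemLp (fun ξ => NLS.symbolD s ξ * φ ξ) 2 := by
  have h1 : MemLp (fun ξ => ‖φ ξ‖ + ‖SchwartzMap.smulLeftCLM ℂ (NLS.symbolD 2) φ ξ‖) 2 :=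
    (φ.memLp 2).norm.add ((SchwartzMap.smulLeftCLM ℂ (NLS.symbolD 2) φ).memLp 2).norm
  refine h1.mono ((continuous_symbolD hs).mul φ.continuous).aestronglyMeasurable
    (ae_of_all _ fun ξ => ?_)
  rw [SchwartzMap.smulLeftCLM_apply_apply symbolD_two_hasTemperateGrowth, smul_eq_mul, norm_mul,
    norm_mul, norm_symbolD, norm_symbolD, Real.norm_of_nonneg (by positivity)]
  have hb : (2 * Real.pi * ‖ξ‖) ^ s ≤ 1 + (2 * Real.pi * ‖ξ‖) ^ (2 : ℝ) := by
    have h0 : 0 ≤ 2 * Real.pi * ‖ξ‖ := by positivity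
    rcases le_total (2 * Real.pi * ‖ξ‖) 1 with h | h
    · have := Real.rpow_le_one h0 h hs
      have := Real.rpow_nonneg h0 2
      linarith
    · have := Real.rpow_le_rpow_of_exponent_le h hs2
      linarith
  nlinarith [mul_le_mul_of_nonneg_right hb (norm_nonneg (φ ξ))]

/-- The functions `D ^ s φ`, with `φ` a Schwartz function on the frequency side, have trivial
orthogonal complement in `L²`. -/
theorem eq_zero_of_forall_inner_symbolD_mul_schwartz {s : ℝ} (hs : 0 ≤ s) (hs2 : s ≤ 2)
    (v : Lp ℂ 2 (volume : Measure NLS.R3))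
    (hv : ∀ φ : 𝓢(NLS.R3, ℂ),
      -- The `star` cancels the conjugation in the first slot, leaving the bilinear pairing.
      inner ℂ (star ((memLp_symbolD_mul_schwartz hs hs2 φ).toLp _)) v = 0) : v = 0 := by
  have hint : LocallyIntegrable (fun ξ => NLS.symbolD s ξ * v ξ) :=
    ((Lp.memLp v).locallyIntegrable (by norm_num)).continuous_mul (continuous_symbolD hs)
  have h0 : ∀ᵐ ξ : NLS.R3, NLS.symbolD s ξ * v ξ = 0 := by
    refine ae_eq_zero_of_integral_contDiff_smul_eq_zero hint fun φ hφ hc => ?_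
    have h₁ : HasCompactSupport (Complex.ofRealCLM ∘ φ) := hc.comp_left rfl
    have h₂ : ContDiff ℝ (⊤ : ℕ∞) (Complex.ofRealCLM ∘ φ) := Complex.ofRealCLM.contDiff.comp hφ
    rw [← hv (h₁.toSchwartzMap h₂), L2.inner_def]
    refine integral_congr_ae ?_
    filter_upwards [Lp.coeFn_star ((memLp_symbolD_mul_schwartz hs hs2 (h₁.toSchwartzMap h₂)).toLp _),
      (memLp_symbolD_mul_schwartz hs hs2 (h₁.toSchwartzMap h₂)).coeFn_toLp] with ξ h1 h2
    rw [h1, Pi.star_apply, h2]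
    simp
    ring
  refine (Lp.eq_zero_iff_ae_eq_zero).2 ?_
  -- The weight vanishes only at the origin, a null set.
  filter_upwards [h0, (volume : Measure NLS.R3).ae_ne 0] with ξ h1 h2
  exact (mul_eq_zero.1 h1).resolve_left (symbolD_ne_zero s h2)

/-! ### The tested free evolution near time zero -/

/-- The free evolution tested against the Fourier transform of `(2π|ξ|)² φ`. -/
theorem schrodinger_apply_fourier {h : 𝓢'(NLS.R3, ℂ)} {f : NLS.R3 → ℂ}
    (hf : NLS.IsHDotFourier (1 / 2) h f) (t : ℝ) (φ : 𝓢(NLS.R3, ℂ)) :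
    NLS.schrodinger t h (𝓕 (SchwartzMap.smulLeftCLM ℂ (NLS.symbolD 2) φ)) =
      ∫ ξ, NLS.schrodingerSymbol t ξ *
        ((NLS.symbolD (3 / 2) ξ * φ ξ) * (NLS.symbolD (1 / 2) ξ * f ξ)) := by
  unfold NLS.schrodinger
  rw [TemperedDistribution.fourierMultiplierCLM_apply_apply, FourierTransform.fourierInv_fourier_eq,
    ← TemperedDistribution.fourier_apply, hf.fourier_eq]
  refine integral_congr_ae (ae_of_all _ fun ξ => ?_)
  simp only [SchwartzMap.smulLeftCLM_apply_apply (NLS.schrodingerSymbol_hasTemperateGrowth t),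
    SchwartzMap.smulLeftCLM_apply_apply symbolD_two_hasTemperateGrowth, smul_eq_mul]
  -- The smooth weight of order 2 is split so that both `φ` and `f` carry factors that put them in
  -- `L²`.
  have e : NLS.symbolD 2 ξ = NLS.symbolD (3 / 2) ξ * NLS.symbolD (1 / 2) ξ := by
    rw [symbolD_mul_symbolD (by norm_num)]; norm_num
  rw [e]
  ring

theorem schrodingerSymbol_eq (t : ℝ) (ξ : NLS.R3) :
    NLS.schrodingerSymbol t ξ =
      Complex.exp (Complex.I * ((-(t * (2 * Real.pi * ‖ξ‖) ^ 2) : ℝ) : ℂ)) := by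
  unfold NLS.schrodingerSymbol
  congr 1
  push_cast
  ring

theorem schrodingerSymbol_zero (ξ : NLS.R3) : NLS.schrodingerSymbol 0 ξ = 1 := by
  simp [NLS.schrodingerSymbol]

theorem norm_schrodingerSymbol (t : ℝ) (ξ : NLS.R3) : ‖NLS.schrodingerSymbol t ξ‖ = 1 := by
  rw [schrodingerSymbol_eq, Complex.norm_exp_I_mul_ofReal]

theorem norm_schrodingerSymbol_sub_one_le {t : ℝ} (ht : 0 ≤ t) (ξ : NLS.R3) :
    ‖NLS.schrodingerSymbol t ξ - 1‖ ≤ t * ‖NLS.symbolD 2 ξ‖ := by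
  rw [schrodingerSymbol_eq]
  refine Real.norm_exp_I_mul_ofReal_sub_one_le.trans ?_
  rw [norm_symbolD, norm_neg, Real.norm_of_nonneg (by positivity)]
  norm_num

/-- The bound `|exp (-iθ) - 1| ≤ |θ|` costs a factor `t (2π|ξ|)²`, which the Schwartz function
absorbs; Cauchy-Schwarz then leaves only the `Ḣ^{1/2}` norm of `h`. -/
theorem norm_schrodinger_apply_sub_le {h : 𝓢'(NLS.R3, ℂ)} {f : NLS.R3 → ℂ}
    (hf : NLS.IsHDotFourier (1 / 2) h f) {t : ℝ} (ht : 0 ≤ t) (φ : 𝓢(NLS.R3, ℂ)) :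
    ‖NLS.schrodinger t h (𝓕 (SchwartzMap.smulLeftCLM ℂ (NLS.symbolD 2) φ)) -
      NLS.schrodinger 0 h (𝓕 (SchwartzMap.smulLeftCLM ℂ (NLS.symbolD 2) φ))‖ ≤
      ‖(memLp_symbolD_mul_schwartz (s := 3 / 2) (by norm_num) (by norm_num)
        (SchwartzMap.smulLeftCLM ℂ (NLS.symbolD 2) φ)).toLp _‖ * ‖hf.memLp.toLp _‖ * t := by
  have hw := memLp_symbolD_mul_schwartz (s := 3 / 2) (by norm_num) (by norm_num) φ
  have hw2 := memLp_symbolD_mul_schwartz (s := 3 / 2) (by norm_num) (by norm_num)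
    (SchwartzMap.smulLeftCLM ℂ (NLS.symbolD 2) φ)
  have hI : Integrable (fun ξ => (NLS.symbolD (3 / 2) ξ * φ ξ) * (NLS.symbolD (1 / 2) ξ * f ξ)) :=
    hw.integrable_mul hf.memLp
  have hIt (t : ℝ) : Integrable (fun ξ => NLS.schrodingerSymbol t ξ *
      ((NLS.symbolD (3 / 2) ξ * φ ξ) * (NLS.symbolD (1 / 2) ξ * f ξ))) :=
    hI.bdd_mul (c := 1)
      (NLS.schrodingerSymbol_hasTemperateGrowth t).1.continuous.aestronglyMeasurable
      (ae_of_all _ fun ξ => (norm_schrodingerSymbol t ξ).le)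
  rw [schrodinger_apply_fourier hf, schrodinger_apply_fourier hf, ← integral_sub (hIt t) (hIt 0)]
  calc _ ≤ ∫ ξ, t * (‖NLS.symbolD (3 / 2) ξ *
          SchwartzMap.smulLeftCLM ℂ (NLS.symbolD 2) φ ξ‖ * ‖NLS.symbolD (1 / 2) ξ * f ξ‖) := by
        refine norm_integral_le_of_norm_le
          ((hw2.norm.integrable_mul hf.memLp.norm).const_mul t) (ae_of_all _ fun ξ => ?_)
        rw [SchwartzMap.smulLeftCLM_apply_apply symbolD_two_hasTemperateGrowth,
          schrodingerSymbol_zero, ← sub_mul, smul_eq_mul]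
        have h1 := norm_schrodingerSymbol_sub_one_le ht ξ
        calc _ = ‖NLS.schrodingerSymbol t ξ - 1‖ * (‖NLS.symbolD (3 / 2) ξ * φ ξ‖ *
              ‖NLS.symbolD (1 / 2) ξ * f ξ‖) := by rw [norm_mul, norm_mul]
          _ ≤ t * ‖NLS.symbolD 2 ξ‖ * (‖NLS.symbolD (3 / 2) ξ * φ ξ‖ *
              ‖NLS.symbolD (1 / 2) ξ * f ξ‖) := by gcongr
          _ = _ := by simp only [norm_mul]; ring
    _ ≤ _ := by
        rw [integral_const_mul, mul_comm]
        exact mul_le_mul_of_nonneg_right (integral_norm_mul_norm_le_of_memLp_two hw2 hf.memLp) ht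

theorem schrodinger_zero_apply_fourier {h : 𝓢'(NLS.R3, ℂ)} {f : NLS.R3 → ℂ}
    (hf : NLS.IsHDotFourier (1 / 2) h f) (φ : 𝓢(NLS.R3, ℂ)) :
    NLS.schrodinger 0 h (𝓕 (SchwartzMap.smulLeftCLM ℂ (NLS.symbolD 2) φ)) =
      inner ℂ (star ((memLp_symbolD_mul_schwartz (s := 3 / 2) (by norm_num) (by norm_num)
        φ).toLp _)) (hf.memLp.toLp _) := by
  have hw := memLp_symbolD_mul_schwartz (s := 3 / 2) (by norm_num) (by norm_num) φ
  rw [schrodinger_apply_fourier hf, L2.inner_def]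
  refine integral_congr_ae ?_
  filter_upwards [Lp.coeFn_star (hw.toLp _), hw.coeFn_toLp, hf.memLp.coeFn_toLp] with ξ h1 h2 h3
  rw [h1, Pi.star_apply, h2, h3, schrodingerSymbol_zero]
  simp
  ring

/-! ### Weak convergence -/

/-- If the scattering norms of the free evolutions of an `Ḣ^{1/2}`-bounded sequence tend to zero,
then the weighted Fourier transforms test to zero against every `L²` function. -/
theorem tendsto_inner_weightedFourier {A : ℝ} {h : ℕ → 𝓢'(NLS.R3, ℂ)} {f : ℕ → NLS.R3 → ℂ}
    (hf : ∀ n, NLS.IsHDotFourier (1 / 2) (h n) (f n)) (hA : ∀ n, ‖(hf n).memLp.toLp _‖ ≤ A)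
    (hS : Tendsto (fun n => NLS.sNorm (Set.Ioi 0) (fun t => NLS.schrodinger t (h n))) atTop (𝓝 0))
    (v : Lp ℂ 2 (volume : Measure NLS.R3)) :
    Tendsto (fun n => inner ℂ v ((hf n).memLp.toLp _)) atTop (𝓝 0) := by
  refine tendsto_inner_zero_of_forall_mem
    (S := Set.range fun φ : 𝓢(NLS.R3, ℂ) => star ((memLp_symbolD_mul_schwartz (s := 3 / 2)
      (by norm_num) (by norm_num) φ).toLp _)) (fun w hw => ?_) hA ?_ v
  · exact eq_zero_of_forall_inner_symbolD_mul_schwartz (s := 3 / 2) (by norm_num) (by norm_num) w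
      fun φ => hw _ (Set.mem_range_self φ)
  rintro _ ⟨φ, rfl⟩
  have hA0 : 0 ≤ A := (norm_nonneg _).trans (hA 0)
  obtain ⟨C, hC, hbound⟩ := exists_enorm_apply_le_distLpNorm 5
    (𝓕 (SchwartzMap.smulLeftCLM ℂ (NLS.symbolD 2) φ))
  rw [Metric.tendsto_atTop]
  intro ε hε
  obtain ⟨η, hη, hmass⟩ := exists_le_lintegral_of_lipschitz_at_zero
    (L := ‖(memLp_symbolD_mul_schwartz (s := 3 / 2) (by norm_num) (by norm_num)
        (SchwartzMap.smulLeftCLM ℂ (NLS.symbolD 2) φ)).toLp _‖ * A) (by positivity) hC hε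
  obtain ⟨N, hN⟩ := eventually_atTop.1 (hS.eventually_lt_const hη)
  refine ⟨N, fun n hn => ?_⟩
  rw [dist_zero_right, ← schrodinger_zero_apply_fourier (hf n)]
  by_contra! hcon
  refine (hN n hn).not_ge (hmass
    (fun t => NLS.schrodinger t (h n) (𝓕 (SchwartzMap.smulLeftCLM ℂ (NLS.symbolD 2) φ)))
    (fun t => NLS.distLpNorm 5 (NLS.schrodinger t (h n))) (fun t ht => ?_)
    (fun t => hbound _) hcon)
  refine (norm_schrodinger_apply_sub_le (hf n) ht φ).trans ?_
  gcongr
  exact hA n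

/-- Weak convergence to zero in a Hilbert space can be tested with inner products. -/
theorem tendsto_toWeakSpace_zero_of_inner {H : Type*} [NormedAddCommGroup H]
    [InnerProductSpace ℂ H] [CompleteSpace H] {x : ℕ → H}
    (hx : ∀ v : H, Tendsto (fun n => inner ℂ v (x n)) atTop (𝓝 0)) :
    Tendsto (fun n => toWeakSpace ℂ H (x n)) atTop (𝓝 0) := by
  have hinj : Function.Injective (topDualPairing ℂ H).flip := by
    intro a b hab
    refine ext_inner_left ℂ fun v => ?_
    exact LinearMap.congr_fun hab (InnerProductSpace.toDual ℂ H v)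
  refine (WeakBilin.tendsto_iff_forall_eval_tendsto _ hinj).2 fun ℓ => ?_
  have h := hx ((InnerProductSpace.toDual ℂ H).symm ℓ)
  simp only [InnerProductSpace.toDual_symm_apply] at h
  rw [← map_zero ℓ] at h
  exact h

theorem lemma3p6 (A : ℝ) (h : ℕ → 𝓢'(NLS.R3, ℂ)) (hh : ∀ n, NLS.MemHDot (1 / 2) (h n))
    (hA : ∀ n, NLS.hDotNorm (1 / 2) (h n) (hh n) ≤ A)
    (hS : Tendsto (fun n => NLS.sNorm (Set.Ioi 0) (fun t => NLS.schrodinger t (h n))) atTop (𝓝 0)) :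
    Tendsto (fun n => toWeakSpace ℂ (Lp ℂ 2 (volume : Measure NLS.R3))
      (NLS.fracD (1 / 2) (h n) (hh n))) atTop (𝓝 0) := by
  have hf := fun n => (hh n).choose_spec
  have hnorm : ∀ n, ‖(hf n).memLp.toLp _‖ ≤ A := fun n =>
    ((Lp.fourierTransformₗᵢ NLS.R3 ℂ).symm.norm_map _).ge.trans (hA n)
  have hG := tendsto_inner_weightedFourier hf hnorm hS
  refine tendsto_toWeakSpace_zero_of_inner fun v => ?_
  -- Plancherel moves the test vector to the frequency side.
  refine (hG (𝓕 v)).congr fun n => ?_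
  have e := Lp.inner_fourier_eq v (NLS.fracD (1 / 2) (h n) (hh n))
  rw [← e]
  unfold NLS.fracD
  rw [FourierTransform.fourier_fourierInv_eq]
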